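/- Let $k$ be an infinite field, $S=k[x_0,\dots,x_n]$ with its standard grading, and let $f_0,\dots,f_r\in S$ be $k$-linearly independent forms of the same degree. Let $I=(f_0,\dots,f_r)\subset S$, let $\phi=(f_0:\dots:f_r):\mathbf P^n\dashrightarrow\mathbf P^r$ be the associated rational map, and let $\ell(I)=1+\dim\operatorname{im}(\phi)$ be the analytic spread of $I$, where $\operatorname{im}(\phi)$ is the closure in $\mathbf P^r$ of $\phi(\mathbf P^n\setminus V(I))$. A homogeneous presentation matrix of a homogeneous ideal $J\subset S$ is the matrix $A$ of a homogeneous free presentation $F\xrightarrow{A}G\to J\to 0$ with $F$, $G$ of finite rank, in which the given basis of $G$ maps to a homogeneous minimal generating set of $J$. A row ideal of $A$ is the ideal generated by the entries of one row of $A$. An ideal is linear if it is generated by linear forms (the zero ideal is linear). Suppose that $I$ has a homogeneous presentation matrix with at least one row ideal that is linear, has codimension at least $\ell(I)-1$, and does not contain $I$. Then for every $d\ge 1$ the power $I^d$ has a homogeneous presentation matrix all of whose row ideals are linear, have codimension exactly $\ell(I)-1$, and do not contain $I$. -/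

import Mathlib

namespace RowIdeals

open MvPolynomial

attribute [local instance] MvPolynomial.gradedAlgebra

/-- The projective space `Proj k[X₀, …, Xₙ]` (all homogeneous primes that do not contain the
irrelevant ideal, with the Zariski topology). -/
abbrev ProjSpace (k : Type*) [Field k] (n : ℕ) : Type _ :=
  ProjectiveSpectrum (homogeneousSubmodule (Fin (n + 1)) k)

section RationalMap

variable {k : Type*} [Field k] {n r : ℕ} (f : Fin (r + 1) → MvPolynomial (Fin (n + 1)) k)

/-- The complement of `V(f₀, …, fᵣ)` in `Pⁿ`, where the rational map `(f₀ : … : fᵣ)` given by forms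
of the same degree is a morphism. -/
def regularLocus : Set (ProjSpace k n) :=
  {x | ¬ Ideal.span (Set.range f) ≤ x.asHomogeneousIdeal.toIdeal}

/-- The rational map `Pⁿ → Pʳ` defined by forms `f₀, …, fᵣ` of the same degree, on points: the point
`x` goes to the homogeneous prime whose homogeneous elements are the forms `F(T₀, …, Tᵣ)` with
`F(f₀, …, fᵣ)` in the prime of `x`.  (If the `fᵢ` have positive degree, the preimage of the prime of
`x` under `Tᵢ ↦ fᵢ` is homogeneous, and so equal to its homogeneous core.) -/
noncomputable def ratMap (x : regularLocus f) : ProjSpace k r where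
  asHomogeneousIdeal :=
    (x.1.asHomogeneousIdeal.toIdeal.comap (aeval f : MvPolynomial (Fin (r + 1)) k →ₐ[k] _)
      ).homogeneousCore (homogeneousSubmodule (Fin (r + 1)) k)
  isPrime := by
    have := x.1.isPrime
    exact Ideal.IsPrime.homogeneousCore (Ideal.comap_isPrime _ _)
  not_irrelevant_le := by
    intro h
    apply x.2
    rw [Ideal.span_le]
    rintro _ ⟨i, rfl⟩
    have h1 : (X i : MvPolynomial (Fin (r + 1)) k) ∈
        (HomogeneousIdeal.irrelevant (homogeneousSubmodule (Fin (r + 1)) k)) := by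
      rw [HomogeneousIdeal.mem_irrelevant_iff, GradedRing.proj_apply,
        DirectSum.decompose_of_mem_ne _ (i := 1) (isHomogeneous_X k i) one_ne_zero]
    have h2 := Ideal.toIdeal_homogeneousCore_le _ _ (h h1)
    simpa using h2

/-- The image of the rational map `(f₀ : … : fᵣ)`, a closed subset of `Pʳ`. -/
noncomputable def ratImage : Set (ProjSpace k r) := closure (Set.range (ratMap f))

/-- The analytic spread of the ideal generated by the forms `f₀, …, fᵣ` of the same degree:
one plus the dimension of the image of the rational map `(f₀ : … : fᵣ)`. -/
noncomputable def analyticSpread : WithBot ℕ∞ := topologicalKrullDim (ratImage f) + 1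

end RationalMap

section Presentation

variable {k : Type*} [Field k] {n s m : ℕ}

/-- `A` is a homogeneous presentation matrix of the ideal `J` with respect to the homogeneous
minimal generating set `g₁, …, gₛ`: there is a homogeneous exact sequence `F → G → J → 0` with
`F = ⊕ S(-eⱼ)` and `G = ⊕ S(-cᵢ)`, where `F → G` is given by `A` and `G → J` by the `gᵢ`. -/
structure IsHomogeneousPresentation (J : Ideal (MvPolynomial (Fin (n + 1)) k))
    (g : Fin s → MvPolynomial (Fin (n + 1)) k)
    (A : Matrix (Fin s) (Fin m) (MvPolynomial (Fin (n + 1)) k)) : Prop where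
  span_eq : Ideal.span (Set.range g) = J
  minimal : ∀ i, Ideal.span (g '' {i}ᶜ) ≠ J
  homogeneous : ∃ (c : Fin s → ℕ) (e : Fin m → ℕ), (∀ i, (g i).IsHomogeneous (c i)) ∧
    ∀ i j, A i j = 0 ∨ ∃ a, a + c i = e j ∧ (A i j).IsHomogeneous a
  exact_seq : Function.Exact A.mulVecLin
    (Fintype.linearCombination (MvPolynomial (Fin (n + 1)) k) g)

/-- The ideal generated by the entries of the `i`-th row of `A`. -/
noncomputable def rowIdeal (A : Matrix (Fin s) (Fin m) (MvPolynomial (Fin (n + 1)) k)) (i : Fin s) :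
    Ideal (MvPolynomial (Fin (n + 1)) k) :=
  Ideal.span (Set.range (A i))

/-- An ideal is linear if it is generated by linear forms. -/
def IsLinear (K : Ideal (MvPolynomial (Fin (n + 1)) k)) : Prop :=
  ∃ L : Set (MvPolynomial (Fin (n + 1)) k), (∀ l ∈ L, l.IsHomogeneous 1) ∧ K = Ideal.span L

end Presentation

end RowIdeals

/-!
Write `U` for the span of the `fᵢ`. The `i`-th row ideal of a presentation matrix with respect to
generators `g` is the colon ideal `(gⱼ : j ≠ i) : gᵢ`. If the `gⱼ` form a basis of a linear system
`W` with `gᵢ(q) ≠ 0` and `gⱼ(q) = 0` for `j ≠ i`, it is the generalized row ideal `R_q(W) = J : W`,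
where `J` is generated by the members of `W` vanishing at `q`.

A minimal prime of the ideal `J` of `W = U` whose zero set contains `q` is the ideal of a component
of a fiber of the rational map if `U` does not vanish at `q`, so it has codimension at most `ℓ - 1`,
and it contains `R_q(U)`. On the other hand a linear row ideal comes from linear syzygies
`∑ⱼ βⱼ gⱼ = 0`, and `∑ⱼ gⱼ(q) βⱼ` is a linear form in `R_q(U)` for every `q`. At a point where only
the `gⱼ` of the chosen row is nonzero these forms generate the given row ideal, so at a general
point `q` they generate a linear prime of codimension at least `ℓ - 1`, which is therefore all of
`R_q(U)`.

Over an infinite field `U ^ d` has a basis dual to evaluation at general points, so the row ideals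
of a presentation with respect to this basis are ideals `R_q(U ^ d)` with `q` general, and
`R_q(U ^ d) = R_q(U)` when `R_q(U)` is prime, because modulo `J` the space `U ^ d` is spanned by one
power `u ^ d`.
-/

namespace RowIdeals

open MvPolynomial

attribute [local instance] MvPolynomial.gradedAlgebra

section ImageDimension

theorem krullDim_le_topologicalKrullDim_of_specializes_iff {X α : Type*} [TopologicalSpace X]
    [Preorder α] {p : α → X} (hp : ∀ a b, p a ⤳ p b ↔ a ≤ b) :
    Order.krullDim α ≤ topologicalKrullDim X := by
  let closureOf (a : α) : (TopologicalSpace.IrreducibleCloseds X)ᵒᵈ :=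
    OrderDual.toDual ⟨closure {p a}, isIrreducible_singleton.closure, isClosed_closure⟩
  have closureOf_le_iff (a b : α) : closureOf a ≤ closureOf b ↔ a ≤ b := by
    rw [← hp, specializes_iff_closure_subset]
    rfl
  rw [topologicalKrullDim, ← Order.krullDim_orderDual (α := TopologicalSpace.IrreducibleCloseds X)]
  exact Order.krullDim_le_of_strictMono closureOf
    (strictMono_of_le_iff_le fun a b ↦ (closureOf_le_iff a b).symm)

variable {k : Type*} [Field k] {n r : ℕ}

theorem X_mem_irrelevant {σ A : Type*} [CommRing A] (i : σ) :
    (X i : MvPolynomial σ A) ∈ HomogeneousIdeal.irrelevant (homogeneousSubmodule σ A) :=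
  HomogeneousIdeal.mem_irrelevant_of_mem _ one_pos (isHomogeneous_X A i)

theorem exists_isHomogeneous_map_eq {σ A B F : Type*} [CommSemiring A] [CommSemiring B]
    [FunLike F (MvPolynomial σ A) B] [RingHomClass F (MvPolynomial σ A) B] (ψ : F) {i : σ}
    (hi : ψ (X i) = 1) (G : MvPolynomial σ A) :
    ∃ (H : MvPolynomial σ A) (N : ℕ), H.IsHomogeneous N ∧ ψ H = ψ G := by
  refine ⟨∑ d ∈ Finset.range (G.totalDegree + 1),
    homogeneousComponent d G * X i ^ (G.totalDegree - d), G.totalDegree, ?_, ?_⟩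
  · refine IsHomogeneous.sum _ _ _ fun d hd ↦ ?_
    have := (homogeneousComponent_isHomogeneous d G).mul
      (isHomogeneous_X_pow i (G.totalDegree - d))
    rwa [Nat.add_sub_cancel' (Finset.mem_range_succ_iff.1 hd)] at this
  · conv_rhs => rw [← sum_homogeneousComponent G]
    simp [hi]

/-- The point of `Pʳ` given by a point `q` of the affine scheme `Spec R` and a homomorphism
`ψ : k[T₀, …, Tᵣ] → R` sending some variable `Tᵢ` to `1`, that is, by a morphism from `Spec R` to
the chart `Tᵢ ≠ 0`.  Its prime is generated by the forms that `ψ` maps into `q`. -/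
noncomputable def projPoint {R : Type*} [CommRing R] (ψ : MvPolynomial (Fin (r + 1)) k →+* R)
    {i : Fin (r + 1)} (hi : ψ (X i) = 1) (q : PrimeSpectrum R) : ProjSpace k r where
  asHomogeneousIdeal := (q.asIdeal.comap ψ).homogeneousCore (homogeneousSubmodule (Fin (r + 1)) k)
  isPrime := (Ideal.comap_isPrime ψ q.asIdeal).homogeneousCore
  not_irrelevant_le h := by
    have hX : X i ∈ q.asIdeal.comap ψ :=
      Ideal.toIdeal_homogeneousCore_le _ _ (h (X_mem_irrelevant i))
    rw [Ideal.mem_comap, hi] at hX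
    exact q.isPrime.one_notMem hX

theorem projPoint_le_iff {R : Type*} [CommRing R] {ψ : MvPolynomial (Fin (r + 1)) k →+* R}
    (hψ : Function.Surjective ψ) {i : Fin (r + 1)} (hi : ψ (X i) = 1) (p q : PrimeSpectrum R) :
    projPoint ψ hi p ≤ projPoint ψ hi q ↔ p ≤ q := by
  refine ⟨fun h b hb ↦ ?_, fun h ↦ Ideal.homogeneousCore_mono _ (Ideal.comap_mono h)⟩
  obtain ⟨G, rfl⟩ := hψ b
  obtain ⟨F, N, hF, hFG⟩ := exists_isHomogeneous_map_eq ψ hi G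
  rw [← hFG] at hb ⊢
  exact Ideal.toIdeal_homogeneousCore_le _ (q.asIdeal.comap ψ)
    (h (Ideal.mem_homogeneousCore_of_homogeneous_of_mem ⟨N, hF⟩ hb))

/-- The generic point of `Pⁿ`. -/
noncomputable def genericPoint (k : Type*) [Field k] (n : ℕ) : ProjSpace k n where
  asHomogeneousIdeal := ⊥
  isPrime := by
    rw [HomogeneousIdeal.toIdeal_bot]
    exact Ideal.isPrime_bot
  not_irrelevant_le h := X_ne_zero (R := k) (0 : Fin (n + 1)) (h (X_mem_irrelevant 0))

variable {f : Fin (r + 1) → MvPolynomial (Fin (n + 1)) k}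

theorem genericPoint_mem_regularLocus {i : Fin (r + 1)} (hi : f i ≠ 0) :
    genericPoint k n ∈ regularLocus f :=
  fun h ↦ hi (h (Ideal.subset_span ⟨i, rfl⟩))

theorem mem_ratImage_of_ker_le {i : Fin (r + 1)} (hi : f i ≠ 0) {x : ProjSpace k r}
    (hx : (RingHom.ker (aeval (R := k) f)).homogeneousCore (homogeneousSubmodule (Fin (r + 1)) k) ≤
      x.asHomogeneousIdeal) :
    x ∈ ratImage f := by
  have hle : ratMap f ⟨genericPoint k n, genericPoint_mem_regularLocus hi⟩ ≤ x := hx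
  exact closure_mono (Set.singleton_subset_iff.2 (Set.mem_range_self _))
    ((ProjectiveSpectrum.le_iff_mem_closure _ _ _).1 hle)

theorem ringKrullDim_le_topologicalKrullDim_ratImage {i j : Fin (r + 1)} (hj : f j ≠ 0)
    {R : Type*} [CommRing R] {ψ : MvPolynomial (Fin (r + 1)) k →+* R}
    (hψ : Function.Surjective ψ) (hi : ψ (X i) = 1)
    (hker : ∀ (F : MvPolynomial (Fin (r + 1)) k) (N : ℕ), F.IsHomogeneous N → aeval f F = 0 →
      ψ F = 0) :
    ringKrullDim R ≤ topologicalKrullDim (ratImage f) := by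
  have hmem (q : PrimeSpectrum R) : projPoint ψ hi q ∈ ratImage f := by
    refine mem_ratImage_of_ker_le hj (Ideal.span_le.2 ?_)
    rintro _ ⟨⟨F, N, hF⟩, hF0, rfl⟩
    refine Ideal.mem_homogeneousCore_of_homogeneous_of_mem ⟨N, hF⟩ ?_
    rw [Ideal.mem_comap, hker F N hF hF0]
    exact q.asIdeal.zero_mem
  refine krullDim_le_topologicalKrullDim_of_specializes_iff
    (p := fun q ↦ (⟨projPoint ψ hi q, hmem q⟩ : ratImage f)) fun a b ↦ ?_
  rw [subtype_specializes_iff, specializes_iff_mem_closure,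
    ← ProjectiveSpectrum.le_iff_mem_closure, projPoint_le_iff hψ]

end ImageDimension

section FiberDimension
theorem aeval_mul_const_of_isHomogeneous {σ A B : Type*} [CommSemiring A] [CommSemiring B]
    [Algebra A B] {F : MvPolynomial σ A} {N : ℕ} (hF : F.IsHomogeneous N) (a : σ → B) (y : B) :
    aeval (fun j ↦ a j * y) F = aeval a F * y ^ N := by
  simp only [aeval_def, eval₂_eq, Finset.sum_mul]
  refine Finset.sum_congr rfl fun c hc ↦ ?_
  rw [hF.degree_eq_sum_deg_support hc]
  simp only [mul_pow, Finset.prod_mul_distrib, Finset.prod_pow_eq_pow_sum, mul_assoc]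

theorem height_le_height_under_of_mem_minimalPrimes {R S : Type*} [CommRing R] [CommRing S]
    [IsNoetherianRing R] [IsNoetherianRing S] [Algebra R S] {Q : Ideal S}
    (hQ : Q ∈ ((Q.under R).map (algebraMap R S)).minimalPrimes) :
    Q.height ≤ (Q.under R).height := by
  have := hQ.isPrime
  have hfiber : (Q.map (Ideal.Quotient.mk ((Q.under R).map (algebraMap R S)))).height = 0 := by
    have := Ideal.isPrime_map_quotientMk_of_isPrime hQ.le
    rw [Ideal.height_eq_zero_iff]
    have := Ideal.minimalPrimes_map_of_surjective Ideal.Quotient.mk_surjective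
      ((Q.under R).map (algebraMap R S)) (f := Ideal.Quotient.mk ((Q.under R).map (algebraMap R S)))
    rw [Ideal.map_quotient_self, Ideal.mk_ker, sup_idem] at this
    exact this.ge ⟨Q, hQ, rfl⟩
  simpa only [hfiber, add_zero] using Ideal.height_le_height_add_of_liesOver (Q.under R) Q

end FiberDimension

section FiberDimension
/-- The homomorphism `Tⱼ ↦ fⱼ / fᵢ`, which describes the rational map `(f₀ : … : fᵣ)` on the open
set `fᵢ ≠ 0`. -/
noncomputable def chartMap (k : Type*) {ι A : Type*} [CommRing k] [CommRing A] [Algebra k A]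
    (f : ι → A) (i : ι) : MvPolynomial ι k →ₐ[k] Localization.Away (f i) :=
  aeval fun j ↦ algebraMap A _ (f j) * IsLocalization.Away.invSelf (f i)

section ChartMap

variable {k ι A : Type*} [CommRing k] [CommRing A] [Algebra k A] (f : ι → A) (i : ι)

theorem chartMap_X_self : chartMap k f i (X i) = 1 := by
  rw [chartMap, aeval_X, IsLocalization.Away.mul_invSelf]

theorem chartMap_eq_zero_of_isHomogeneous {F : MvPolynomial ι k} {N : ℕ} (hF : F.IsHomogeneous N)
    (h0 : aeval f F = 0) : chartMap k f i F = 0 := by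
  have hcomp := aeval_algebraMap_apply (Localization.Away (f i)) f F
  rw [h0, map_zero] at hcomp
  rw [chartMap, aeval_mul_const_of_isHomogeneous hF]
  exact mul_eq_zero_of_left hcomp _

variable {f i}

theorem algebraMap_mul_invSelf_mem_range_chartMap {u : A}
    (hu : u ∈ Submodule.span k (Set.range f)) :
    algebraMap A (Localization.Away (f i)) u * IsLocalization.Away.invSelf (f i) ∈
      (chartMap k f i).range := by
  induction hu using Submodule.span_induction with
  | mem u hu =>
    obtain ⟨j, rfl⟩ := hu
    exact ⟨X j, aeval_X _ _⟩
  | zero => simp only [map_zero, zero_mul, zero_mem]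
  | add u v _ _ hu hv => simpa only [map_add, add_mul] using add_mem hu hv
  | smul c u _ hu =>
    simpa only [Algebra.smul_def, map_mul, mul_assoc, ← IsScalarTower.algebraMap_apply] using
      Subalgebra.smul_mem _ hu c

theorem map_mem_minimalPrimes_map_under_range_chartMap {T : Set A}
    (hT : T ⊆ Submodule.span k (Set.range f)) {Q : Ideal A}
    (hQ : Q ∈ (Ideal.span T).minimalPrimes) (hi : f i ∉ Q) :
    Q.map (algebraMap A (Localization.Away (f i))) ∈
      (((Q.map (algebraMap A (Localization.Away (f i)))).under (chartMap k f i).range).map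
        (algebraMap _ (Localization.Away (f i)))).minimalPrimes := by
  have hQprime := hQ.isPrime
  have hdisj := (Ideal.disjoint_powers_iff_notMem (f i) hQprime.isRadical).2 hi
  have hmin : Q.map (algebraMap A (Localization.Away (f i))) ∈
      ((Ideal.span T).map (algebraMap A (Localization.Away (f i)))).minimalPrimes := by
    rw [IsLocalization.minimalPrimes_map (Submonoid.powers (f i)), Set.mem_preimage]
    rwa [IsLocalization.under_map_of_isPrime_disjoint _ _ hQprime hdisj]
  refine ⟨⟨hmin.isPrime, Ideal.map_comap_le⟩, fun P hP hle ↦ hmin.2 ⟨hP.1, ?_⟩ hle⟩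
  rw [Ideal.map_span, Ideal.span_le]
  rintro _ ⟨u, hu, rfl⟩
  -- Up to the unit `fᵢ`, the generators of `T` lie in the range of `chartMap`.
  have hmem : algebraMap A _ u * IsLocalization.Away.invSelf (f i) ∈ P :=
    hP.2 (Ideal.mem_map_of_mem (algebraMap (chartMap k f i).range _)
      (x := ⟨_, algebraMap_mul_invSelf_mem_range_chartMap (hT hu)⟩)
      (Ideal.mul_mem_right _ _ (Ideal.mem_map_of_mem _ (hQ.le (Ideal.subset_span hu)))))
  have := P.mul_mem_right (algebraMap A _ (f i)) hmem
  rwa [mul_assoc, mul_comm (IsLocalization.Away.invSelf _), IsLocalization.Away.mul_invSelf,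
    mul_one] at this

end ChartMap

variable {k : Type*} [Field k] {n r : ℕ}

theorem height_le_topologicalKrullDim_ratImage {f : Fin (r + 1) → MvPolynomial (Fin (n + 1)) k}
    {T : Set (MvPolynomial (Fin (n + 1)) k)} (hT : T ⊆ Submodule.span k (Set.range f))
    {Q : Ideal (MvPolynomial (Fin (n + 1)) k)} (hQ : Q ∈ (Ideal.span T).minimalPrimes)
    {i : Fin (r + 1)} (hi : f i ∉ Q) :
    (Q.height : WithBot ℕ∞) ≤ topologicalKrullDim (ratImage f) := by
  have hQprime := hQ.isPrime
  have hsurj := (chartMap k f i).rangeRestrict_surjective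
  have : IsNoetherianRing (Localization.Away (f i)) :=
    IsLocalization.isNoetherianRing (Submonoid.powers (f i)) _ inferInstance
  have : IsNoetherianRing (chartMap k f i).range :=
    isNoetherianRing_of_surjective _ _ (chartMap k f i).rangeRestrict.toRingHom hsurj
  have hmin := map_mem_minimalPrimes_map_under_range_chartMap hT hQ hi
  have := hmin.isPrime
  have hi0 : f i ≠ 0 := ne_of_mem_of_not_mem Q.zero_mem hi |>.symm
  calc (Q.height : WithBot ℕ∞)
      = (Q.map (algebraMap _ (Localization.Away (f i)))).height := by
        rw [IsLocalization.height_map_of_disjoint (Submonoid.powers (f i)) Q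
          ((Ideal.disjoint_powers_iff_notMem (f i) hQprime.isRadical).2 hi)]
    _ ≤ ((Q.map (algebraMap _ _)).under (chartMap k f i).range).height :=
        WithBot.coe_le_coe.2 (height_le_height_under_of_mem_minimalPrimes hmin)
    _ ≤ ringKrullDim (chartMap k f i).range :=
        Ideal.height_le_ringKrullDim_of_ne_top Ideal.IsPrime.ne_top'
    _ ≤ topologicalKrullDim (ratImage f) :=
        ringKrullDim_le_topologicalKrullDim_ratImage hi0
          (ψ := (chartMap k f i).rangeRestrict.toRingHom) hsurj
          (Subtype.ext (chartMap_X_self f i))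
          fun F N hF h0 ↦ Subtype.ext (chartMap_eq_zero_of_isHomogeneous f i hF h0)

end FiberDimension

section HomogeneousGenerators

variable {σ R : Type*} [CommRing R] {δ : ℕ}

theorem homogeneousComponent_mul_of_isHomogeneous (a : MvPolynomial σ R) {c : ℕ}
    {b : MvPolynomial σ R} (hb : b.IsHomogeneous c) (d : ℕ) :
    homogeneousComponent d (a * b) =
      if c ≤ d then homogeneousComponent (d - c) a * b else 0 := by
  simp only [← decomposition.decompose'_apply]
  exact DirectSum.coe_decompose_mul_of_right_mem (homogeneousSubmodule σ R) d hb

theorem homogeneousComponent_eq_zero_of_mem_ideal_span {T : Set (MvPolynomial σ R)}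
    (hT : ∀ t ∈ T, t.IsHomogeneous δ) {p : MvPolynomial σ R} (hp : p ∈ Ideal.span T) {d : ℕ}
    (hd : d < δ) : homogeneousComponent d p = 0 := by
  induction hp using Submodule.closure_induction with
  | zero => exact map_zero _
  | add x y _ _ hx hy => rw [map_add, hx, hy, add_zero]
  | smul_mem a x hx =>
    rw [smul_eq_mul, homogeneousComponent_mul_of_isHomogeneous _ (hT x hx), if_neg hd.not_ge]

theorem homogeneousComponent_mem_of_mem_ideal_span {U : Submodule R (MvPolynomial σ R)}
    (hU : U ≤ homogeneousSubmodule σ R δ) {p : MvPolynomial σ R}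
    (hp : p ∈ Ideal.span (U : Set (MvPolynomial σ R))) : homogeneousComponent δ p ∈ U := by
  induction hp using Submodule.closure_induction with
  | zero => simpa only [map_zero] using U.zero_mem
  | add x y _ _ hx hy => simpa only [map_add] using U.add_mem hx hy
  | smul_mem a x hx =>
    rw [smul_eq_mul, homogeneousComponent_mul_of_isHomogeneous _ (hU hx), if_pos le_rfl,
      Nat.sub_self, homogeneousComponent_zero, ← smul_eq_C_mul]
    exact U.smul_mem _ hx

theorem mem_ideal_span_iff_of_isHomogeneous {U : Submodule R (MvPolynomial σ R)}
    (hU : U ≤ homogeneousSubmodule σ R δ) {p : MvPolynomial σ R} (hp : p.IsHomogeneous δ) :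
    p ∈ Ideal.span (U : Set (MvPolynomial σ R)) ↔ p ∈ U := by
  refine ⟨fun h ↦ ?_, fun h ↦ Ideal.subset_span h⟩
  simpa only [homogeneousComponent_eq_self hp] using
    homogeneousComponent_mem_of_mem_ideal_span hU h

theorem homogeneousComponent_mem_ideal_span_image_compl {ι : Type*} {g : ι → MvPolynomial σ R}
    {c : ι → ℕ} (hc : ∀ i, (g i).IsHomogeneous (c i)) {i : ι} (hi : δ < c i)
    {p : MvPolynomial σ R} (hp : p ∈ Ideal.span (Set.range g)) :
    homogeneousComponent δ p ∈ Ideal.span (g '' {i}ᶜ) := by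
  induction hp using Submodule.closure_induction with
  | zero => simpa only [map_zero] using Ideal.zero_mem _
  | add x y _ _ hx hy => simpa only [map_add] using Ideal.add_mem _ hx hy
  | smul_mem a x hx =>
    obtain ⟨j, rfl⟩ := hx
    rw [smul_eq_mul, homogeneousComponent_mul_of_isHomogeneous _ (hc j)]
    split_ifs with hj
    · have hji : j ≠ i := fun h ↦ (hi.trans_le (h ▸ hj)).false
      exact Ideal.mul_mem_left _ _ (Ideal.subset_span ⟨j, hji, rfl⟩)
    · exact Ideal.zero_mem _

theorem isHomogeneous_of_minimal {T : Set (MvPolynomial σ R)} (hT : ∀ t ∈ T, t.IsHomogeneous δ)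
    {ι : Type*} {g : ι → MvPolynomial σ R} (hspan : Ideal.span (Set.range g) = Ideal.span T)
    {c : ι → ℕ} (hc : ∀ i, (g i).IsHomogeneous (c i)) {i : ι}
    (hmin : Ideal.span (g '' {i}ᶜ) ≠ Ideal.span T) : (g i).IsHomogeneous δ := by
  rcases lt_trichotomy (c i) δ with h | h | h
  · have hi : g i ∈ Ideal.span T := hspan ▸ Ideal.subset_span ⟨i, rfl⟩
    rw [← homogeneousComponent_eq_self (hc i),
      homogeneousComponent_eq_zero_of_mem_ideal_span hT hi h]
    exact isHomogeneous_zero _ _ _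
  · exact h ▸ hc i
  · refine absurd (le_antisymm ?_ (Ideal.span_le.2 fun t ht ↦ ?_)) hmin
    · exact (Ideal.span_mono (Set.image_subset_range _ _)).trans hspan.le
    · rw [SetLike.mem_coe, ← homogeneousComponent_eq_self (hT t ht)]
      exact homogeneousComponent_mem_ideal_span_image_compl hc h (hspan ▸ Ideal.subset_span ht)

end HomogeneousGenerators

section LinearIdeals

variable {σ k : Type*} [Field k] {V : Submodule k (MvPolynomial σ k)}

theorem exists_algHom_ker_eq_span (hV : V ≤ homogeneousSubmodule σ k 1) :
    ∃ φ : MvPolynomial σ k →ₐ[k] MvPolynomial σ k,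
      RingHom.ker φ = Ideal.span (V : Set (MvPolynomial σ k)) := by
  -- The substitution `φ` given by `l ↦ l - p l`, for a linear projection `p` onto `V`, kills `V`
  -- and is the identity modulo `V`.
  obtain ⟨p, hp⟩ := V.subtype.exists_leftInverse_of_injective V.ker_subtype
  let φ : MvPolynomial σ k →ₐ[k] MvPolynomial σ k := aeval fun j ↦ X j - (p (X j)).1
  have hφ (l : MvPolynomial σ k) (hl : l ∈ homogeneousSubmodule σ k 1) : φ l = l - (p l).1 := by
    rw [homogeneousSubmodule_one_eq_span_X] at hl
    refine LinearMap.eqOn_span (f := φ.toLinearMap) (g := LinearMap.id - V.subtype ∘ₗ p) ?_ hl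
    rintro _ ⟨j, rfl⟩
    exact aeval_X _ _
  refine ⟨φ, le_antisymm (fun a ha ↦ ?_) (Ideal.span_le.2 fun l hl ↦ ?_)⟩
  · have hmod : (Ideal.Quotient.mkₐ k (Ideal.span (V : Set (MvPolynomial σ k)))).comp φ =
        Ideal.Quotient.mkₐ k _ := by
      refine MvPolynomial.algHom_ext fun j ↦ ?_
      rw [AlgHom.comp_apply, aeval_X, map_sub, sub_eq_self]
      exact Ideal.Quotient.eq_zero_iff_mem.2 (Ideal.subset_span (p (X j)).2)
    refine Ideal.Quotient.eq_zero_iff_mem.1 ((DFunLike.congr_fun hmod a).symm.trans ?_)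
    rw [AlgHom.comp_apply, RingHom.mem_ker.1 ha, map_zero]
  · have hpl : p l = ⟨l, hl⟩ := LinearMap.congr_fun hp ⟨l, hl⟩
    exact (hφ l (hV hl)).trans (by rw [hpl, sub_self])

theorem isPrime_span_of_le_homogeneousSubmodule_one (hV : V ≤ homogeneousSubmodule σ k 1) :
    (Ideal.span (V : Set (MvPolynomial σ k))).IsPrime := by
  obtain ⟨φ, hφ⟩ := exists_algHom_ker_eq_span hV
  exact hφ ▸ RingHom.ker_isPrime φ

theorem length_le_height_span (hV : V ≤ homogeneousSubmodule σ k 1) :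
    Module.length k V ≤ (Ideal.span (V : Set (MvPolynomial σ k))).height := by
  have hmap (W : Submodule k V) : W.map V.subtype ≤ homogeneousSubmodule σ k 1 :=
    (V.map_subtype_le W).trans hV
  let F (W : Submodule k V) : PrimeSpectrum (MvPolynomial σ k) :=
    ⟨_, isPrime_span_of_le_homogeneousSubmodule_one (hmap W)⟩
  have hF : StrictMono F := by
    refine strictMono_of_le_iff_le fun W W' ↦ ⟨fun h ↦ ?_, fun h w hw ↦ ?_⟩
    · exact Ideal.span_mono (Submodule.map_mono h)
    · obtain ⟨w', hw', heq⟩ := (mem_ideal_span_iff_of_isHomogeneous (hmap W') (hV w.2)).1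
        (h (Ideal.subset_span ⟨w, hw, rfl⟩))
      exact V.subtype_injective heq ▸ hw'
  calc Module.length k V = Order.height (⊤ : Submodule k V) := Module.length_eq_height k V
    _ ≤ Order.height (F ⊤) := Order.height_le_height_apply_of_strictMono F hF ⊤
    _ = (Ideal.span (V : Set (MvPolynomial σ k))).height := by
      rw [← PrimeSpectrum.height_eq_orderHeight]
      simp only [F, Submodule.map_subtype_top]

theorem finiteDimensional_of_le_homogeneousSubmodule [Finite σ] {δ : ℕ}
    (hV : V ≤ homogeneousSubmodule σ k δ) : FiniteDimensional k V :=
  have : Module.Finite k (homogeneousSubmodule σ k δ) :=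
    Module.Finite.iff_fg.2 (homogeneousSubmodule_fg σ k δ)
  Submodule.finiteDimensional_of_le hV

theorem spanFinrank_ideal_span_le_finrank {k A : Type*} [Field k] [CommRing A] [Algebra k A]
    (V : Submodule k A) [FiniteDimensional k V] :
    (Ideal.span (V : Set A)).spanFinrank ≤ Module.finrank k V := by
  have hV : V.FG := Module.Finite.iff_fg.1 inferInstance
  have hspan : Ideal.span (V : Set A) = Ideal.span V.generators := by
    conv_lhs => rw [← V.span_generators]
    exact Submodule.span_span_of_tower k A V.generators
  calc (Ideal.span (V : Set A)).spanFinrank ≤ V.generators.ncard := by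
        rw [hspan]
        exact Submodule.spanFinrank_span_le_ncard_of_finite hV.finite_generators
    _ = Module.finrank k V := by
      rw [hV.generators_ncard, Module.finrank_eq_spanFinrank_of_free, V.spanFinrank_top]

theorem height_span_eq_finrank [Finite σ] (hV : V ≤ homogeneousSubmodule σ k 1) :
    (Ideal.span (V : Set (MvPolynomial σ k))).height = Module.finrank k V := by
  have := finiteDimensional_of_le_homogeneousSubmodule hV
  refine le_antisymm ?_ (Module.length_eq_finrank k V ▸ length_le_height_span hV)
  exact (Ideal.height_le_spanFinrank _
    (isPrime_span_of_le_homogeneousSubmodule_one hV).ne_top).trans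
    (Nat.cast_le.2 (spanFinrank_ideal_span_le_finrank V))

theorem exists_eval_ne_zero_of_notMem_span [Infinite k] (hV : V ≤ homogeneousSubmodule σ k 1)
    {p : MvPolynomial σ k} (hp : p ∉ Ideal.span (V : Set (MvPolynomial σ k))) :
    ∃ q : σ → k, eval q p ≠ 0 ∧
      Ideal.span (V : Set (MvPolynomial σ k)) ≤ RingHom.ker (eval q) := by
  obtain ⟨φ, hφ⟩ := exists_algHom_ker_eq_span hV
  rw [← hφ] at hp ⊢
  obtain ⟨a, ha⟩ : ∃ a, eval a (φ p) ≠ 0 := by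
    by_contra! h
    exact hp (MvPolynomial.funext fun a ↦ (h a).trans (map_zero _).symm)
  have eval_comp (b : MvPolynomial σ k) : eval (fun j ↦ eval a (φ (X j))) b = eval a (φ b) := by
    have hcomp : (aeval fun j ↦ eval a (φ (X j)) : MvPolynomial σ k →ₐ[k] k) =
        (aeval a : MvPolynomial σ k →ₐ[k] k).comp φ :=
      MvPolynomial.algHom_ext fun j ↦ by simp [MvPolynomial.aeval_eq_eval]
    simpa [MvPolynomial.aeval_eq_eval] using DFunLike.congr_fun hcomp b
  refine ⟨fun j ↦ eval a (φ (X j)), by rwa [eval_comp], fun b hb ↦ ?_⟩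
  rw [RingHom.mem_ker, eval_comp, RingHom.mem_ker.1 hb, map_zero]

theorem IsLinear.exists_submodule {n : ℕ} {K : Ideal (MvPolynomial (Fin (n + 1)) k)}
    (hK : IsLinear K) :
    ∃ V : Submodule k (MvPolynomial (Fin (n + 1)) k),
      V ≤ homogeneousSubmodule (Fin (n + 1)) k 1 ∧ K = Ideal.span (V : Set _) := by
  obtain ⟨L, hL, rfl⟩ := hK
  exact ⟨Submodule.span k L, Submodule.span_le.2 hL, (Submodule.span_span_of_tower k _ L).symm⟩

theorem IsLinear.isPrime {n : ℕ} {K : Ideal (MvPolynomial (Fin (n + 1)) k)} (hK : IsLinear K) :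
    K.IsPrime := by
  obtain ⟨V, hV, rfl⟩ := hK.exists_submodule
  exact isPrime_span_of_le_homogeneousSubmodule_one hV

end LinearIdeals

section Syzygies

variable {σ R : Type*} [CommRing R] {ι : Type*} [Fintype ι] {δ : ℕ} {g : ι → MvPolynomial σ R}

theorem sum_homogeneousComponent_mul_eq_zero (hg : ∀ j, (g j).IsHomogeneous δ)
    {b : ι → MvPolynomial σ R} (hb : ∑ j, b j * g j = 0) (a : ℕ) :
    ∑ j, homogeneousComponent a (b j) * g j = 0 := by
  have h := congrArg (homogeneousComponent (a + δ)) hb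
  simpa only [map_sum, homogeneousComponent_mul_of_isHomogeneous _ (hg _), if_pos,
    Nat.le_add_left, Nat.add_sub_cancel, map_zero] using h

theorem span_homogeneous_syzygies (hg : ∀ j, (g j).IsHomogeneous δ) :
    Submodule.span (MvPolynomial σ R)
      {b : ι → MvPolynomial σ R | ∑ j, b j * g j = 0 ∧ ∃ a, ∀ j, (b j).IsHomogeneous a} =
      LinearMap.ker (Fintype.linearCombination (MvPolynomial σ R) g) := by
  refine le_antisymm (Submodule.span_le.2 fun b hb ↦ ?_) fun b hb ↦ ?_
  · simpa [Fintype.linearCombination_apply] using hb.1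
  have hb : ∑ j, b j * g j = 0 := by simpa [Fintype.linearCombination_apply] using hb
  let N := Finset.univ.sup fun j ↦ (b j).totalDegree
  have hsum : b = ∑ a ∈ Finset.range (N + 1), fun j ↦ homogeneousComponent a (b j) := by
    funext j
    rw [Finset.sum_apply]
    conv_lhs => rw [← sum_homogeneousComponent (b j)]
    refine Finset.sum_subset (Finset.range_mono (Nat.succ_le_succ ?_)) fun a _ ha ↦ ?_
    · exact Finset.le_sup (f := fun j ↦ (b j).totalDegree) (Finset.mem_univ j)
    · exact homogeneousComponent_eq_zero _ _ (by simpa using ha)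
  rw [hsum]
  exact Submodule.sum_mem _ fun a _ ↦ Submodule.subset_span
    ⟨sum_homogeneousComponent_mul_eq_zero hg hb a, a, fun j ↦
      homogeneousComponent_isHomogeneous _ _⟩

end Syzygies

section Presentations

variable {k : Type*} [Field k] {n s m δ : ℕ} {g : Fin s → MvPolynomial (Fin (n + 1)) k}

theorem exists_isHomogeneousPresentation (hg : ∀ i, (g i).IsHomogeneous δ)
    (hmin : ∀ i, Ideal.span (g '' {i}ᶜ) ≠ Ideal.span (Set.range g)) :
    ∃ (m : ℕ) (A : Matrix (Fin s) (Fin m) (MvPolynomial (Fin (n + 1)) k)),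
      IsHomogeneousPresentation (Ideal.span (Set.range g)) g A := by
  obtain ⟨t, htH, ht⟩ := (Submodule.fg_span_iff_fg_span_finset_subset _).1
    (IsNoetherian.noetherian (Submodule.span (MvPolynomial (Fin (n + 1)) k)
      {b : Fin s → MvPolynomial (Fin (n + 1)) k |
        ∑ j, b j * g j = 0 ∧ ∃ a, ∀ j, (b j).IsHomogeneous a}))
  let e := t.equivFin.symm
  refine ⟨t.card, Matrix.of fun i j ↦ (e j).1 i, rfl, hmin, ?_, ?_⟩
  · choose a ha using fun j ↦ (htH (e j).2).2
    exact ⟨fun _ ↦ δ, fun j ↦ a j + δ, hg, fun i j ↦ Or.inr ⟨a j, rfl, ha j i⟩⟩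
  · rw [LinearMap.exact_iff, Matrix.range_mulVecLin, ← span_homogeneous_syzygies hg, ht]
    have hcol : Set.range (Matrix.of fun i j ↦ (e j).1 i).col = Set.range (Subtype.val ∘ e) := rfl
    rw [hcol, Set.range_comp, e.surjective.range_eq, Set.image_univ, Subtype.range_coe]

variable {A : Matrix (Fin s) (Fin m) (MvPolynomial (Fin (n + 1)) k)} {i : Fin s}

theorem mem_rowIdeal_iff_exists_syzygy
    (hA : Function.Exact A.mulVecLin
      (Fintype.linearCombination (MvPolynomial (Fin (n + 1)) k) g))
    {a : MvPolynomial (Fin (n + 1)) k} :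
    a ∈ rowIdeal A i ↔
      ∃ b : Fin s → MvPolynomial (Fin (n + 1)) k, ∑ j, b j * g j = 0 ∧ b i = a := by
  rw [rowIdeal, Ideal.mem_span_range_iff_exists_fun]
  constructor
  · rintro ⟨c, rfl⟩
    refine ⟨A.mulVec c, ?_, ?_⟩
    · simpa [Fintype.linearCombination_apply] using (hA (A.mulVec c)).2 ⟨c, rfl⟩
    · simp [Matrix.mulVec, dotProduct, mul_comm]
  · rintro ⟨b, hb, rfl⟩
    obtain ⟨c, rfl⟩ := (hA b).1 (by simpa [Fintype.linearCombination_apply] using hb)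
    exact ⟨c, by simp [Matrix.mulVec, dotProduct, mul_comm]⟩

theorem mem_rowIdeal_iff_mul_mem_span
    (hA : Function.Exact A.mulVecLin
      (Fintype.linearCombination (MvPolynomial (Fin (n + 1)) k) g))
    {a : MvPolynomial (Fin (n + 1)) k} :
    a ∈ rowIdeal A i ↔ a * g i ∈ Ideal.span (g '' {i}ᶜ) := by
  rw [mem_rowIdeal_iff_exists_syzygy hA, ← Finset.coe_singleton, ← Finset.coe_compl,
    Ideal.span, Submodule.mem_span_image_finset_iff_exists_fun']
  simp only [smul_eq_mul]
  constructor
  · rintro ⟨b, hb, rfl⟩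
    refine ⟨-b, ?_⟩
    rw [Fintype.sum_eq_add_sum_compl i] at hb
    simp [eq_neg_of_add_eq_zero_left hb]
  · rintro ⟨c, hc⟩
    refine ⟨Function.update (-c) i a, ?_, Function.update_self i a (-c)⟩
    rw [Fintype.sum_eq_add_sum_compl i, Function.update_self, ← hc, ← Finset.sum_add_distrib]
    refine Finset.sum_eq_zero fun j hj ↦ ?_
    rw [Function.update_of_ne (by simpa using hj), Pi.neg_apply, neg_mul, add_neg_cancel]

theorem mem_rowIdeal_of_ne
    (hA : Function.Exact A.mulVecLin
      (Fintype.linearCombination (MvPolynomial (Fin (n + 1)) k) g))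
    {j : Fin s} (hj : j ≠ i) : g j ∈ rowIdeal A i :=
  (mem_rowIdeal_iff_mul_mem_span hA).2
    (Ideal.mul_mem_right _ _ (Ideal.subset_span (Set.mem_image_of_mem g hj)))

theorem notMem_rowIdeal_self
    (hA : Function.Exact A.mulVecLin
      (Fintype.linearCombination (MvPolynomial (Fin (n + 1)) k) g))
    (hne : ¬ Ideal.span (Set.range g) ≤ rowIdeal A i) : g i ∉ rowIdeal A i := by
  refine fun hi ↦ hne (Ideal.span_le.2 ?_)
  rintro _ ⟨j, rfl⟩
  obtain rfl | hj := eq_or_ne j i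
  · exact hi
  · exact mem_rowIdeal_of_ne hA hj

theorem exists_linear_syzygies (hg : ∀ j, (g j).IsHomogeneous δ)
    (hA : Function.Exact A.mulVecLin
      (Fintype.linearCombination (MvPolynomial (Fin (n + 1)) k) g))
    (hlin : IsLinear (rowIdeal A i)) :
    ∃ (v : ℕ) (β : Fin v → Fin s → MvPolynomial (Fin (n + 1)) k),
      (∀ a j, (β a j).IsHomogeneous 1) ∧ (∀ a, ∑ j, β a j * g j = 0) ∧
      LinearIndependent k (fun a ↦ β a i) ∧ (rowIdeal A i).height = v := by
  obtain ⟨V, hV, hAV⟩ := hlin.exists_submodule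
  have := finiteDimensional_of_le_homogeneousSubmodule hV
  let w := Module.finBasis k V
  have hw : ∀ a, (w a : MvPolynomial (Fin (n + 1)) k) ∈ rowIdeal A i := fun a ↦
    hAV ▸ Ideal.subset_span (w a).2
  choose b hb hbi using fun a ↦ (mem_rowIdeal_iff_exists_syzygy hA).1 (hw a)
  refine ⟨_, fun a j ↦ homogeneousComponent 1 (b a j),
    fun a j ↦ homogeneousComponent_isHomogeneous _ _,
    fun a ↦ sum_homogeneousComponent_mul_eq_zero hg (hb a) 1, ?_, ?_⟩
  · have hβw : (fun a ↦ homogeneousComponent 1 (b a i)) = V.subtype ∘ w := by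
      funext a
      rw [hbi, homogeneousComponent_eq_self (hV (w a).2)]
      rfl
    rw [hβw]
    exact w.linearIndependent.map' V.subtype V.ker_subtype
  · rw [hAV, height_span_eq_finrank hV]

theorem exists_eval_ne_zero_forall_eval_eq_zero [Infinite k]
    (hA : Function.Exact A.mulVecLin
      (Fintype.linearCombination (MvPolynomial (Fin (n + 1)) k) g))
    (hlin : IsLinear (rowIdeal A i)) (hne : ¬ Ideal.span (Set.range g) ≤ rowIdeal A i) :
    ∃ q, eval q (g i) ≠ 0 ∧ ∀ j ≠ i, eval q (g j) = 0 := by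
  obtain ⟨V, hV, hAV⟩ := hlin.exists_submodule
  obtain ⟨q, hq, hVq⟩ :=
    exists_eval_ne_zero_of_notMem_span hV (hAV ▸ notMem_rowIdeal_self hA hne)
  exact ⟨q, hq, fun j hj ↦ hVq (hAV ▸ mem_rowIdeal_of_ne hA hj)⟩

end Presentations

section GeneralizedRowIdeals

variable {σ k : Type*} [Field k] {U : Submodule k (MvPolynomial σ k)} {q : σ → k}

/-- The ideal generated by the members of a linear system `U` that vanish at the point `q`. -/
noncomputable def vanishingIdealAt (U : Submodule k (MvPolynomial σ k)) (q : σ → k) :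
    Ideal (MvPolynomial σ k) :=
  Ideal.span {u | u ∈ U ∧ eval q u = 0}

/-- The generalized row ideal of a linear system `U` at a point `q`. When `U` has a basis `g` with
`g j` vanishing at `q` for all `j ≠ i`, and not for `j = i`, it is the `i`-th row ideal of a
presentation matrix with respect to `g`. -/
noncomputable def rowIdealAt (U : Submodule k (MvPolynomial σ k)) (q : σ → k) :
    Ideal (MvPolynomial σ k) :=
  (vanishingIdealAt U q).colon U

theorem mem_rowIdealAt {a : MvPolynomial σ k} :
    a ∈ rowIdealAt U q ↔ ∀ u ∈ U, a * u ∈ vanishingIdealAt U q :=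
  Submodule.mem_colon

theorem vanishingIdealAt_le_ker_eval : vanishingIdealAt U q ≤ RingHom.ker (eval q) :=
  Ideal.span_le.2 fun _ hu ↦ hu.2

theorem vanishingIdealAt_le_rowIdealAt : vanishingIdealAt U q ≤ rowIdealAt U q :=
  fun _ ha ↦ mem_rowIdealAt.2 fun u _ ↦ Ideal.mul_mem_right u _ ha

theorem rowIdealAt_le_ker_eval {u₀ : MvPolynomial σ k} (hu₀ : u₀ ∈ U) (hq : eval q u₀ ≠ 0) :
    rowIdealAt U q ≤ RingHom.ker (eval q) := fun a ha ↦ by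
  have h : eval q (a * u₀) = 0 := vanishingIdealAt_le_ker_eval (mem_rowIdealAt.1 ha u₀ hu₀)
  rw [map_mul] at h
  exact (mul_eq_zero.1 h).resolve_right hq

theorem sum_eval_smul_mem_rowIdealAt {ι : Type*} [Fintype ι] {b g : ι → MvPolynomial σ k}
    (hg : ∀ j, g j ∈ U) (hb : ∑ j, b j * g j = 0) :
    ∑ j, eval q (g j) • b j ∈ rowIdealAt U q := by
  refine mem_rowIdealAt.2 fun u hu ↦ ?_
  have h : (∑ j, eval q (g j) • b j) * u =
      ∑ j, b j * (eval q (g j) • u - eval q u • g j) := by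
    simp only [mul_sub, Finset.sum_sub_distrib, mul_smul_comm, ← Finset.smul_sum, hb, smul_zero,
      sub_zero, Finset.sum_mul, smul_mul_assoc]
  rw [h]
  refine Ideal.sum_mem _ fun j _ ↦ Ideal.mul_mem_left _ _ (Ideal.subset_span ⟨?_, ?_⟩)
  · exact U.sub_mem (U.smul_mem _ hu) (U.smul_mem _ (hg j))
  · simp [smul_eval, mul_comm]

end GeneralizedRowIdeals

section GenericRowIdeals

theorem exists_ne_zero_forall_linearIndependent {σ k ι κ E : Type*} [Field k] [AddCommGroup E]
    [Module k E] [Finite ι] [Fintype κ] (g : κ → MvPolynomial σ k) (β : ι → κ → E) {q₀ : σ → k}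
    (h₀ : LinearIndependent k fun a ↦ ∑ j, eval q₀ (g j) • β a j) :
    ∃ h : MvPolynomial σ k, h ≠ 0 ∧
      ∀ q, eval q h ≠ 0 → LinearIndependent k fun a ↦ ∑ j, eval q (g j) • β a j := by
  classical
  have := Fintype.ofFinite ι
  obtain ⟨l, hl⟩ := (Fintype.linearCombination k fun a ↦ ∑ j, eval q₀ (g j) • β a j)
    |>.exists_leftInverse_of_injective
      (LinearMap.ker_eq_bot.2 (linearIndependent_iff_injective_fintypeLinearCombination.1 h₀))
  let D : Matrix ι ι (MvPolynomial σ k) := Matrix.of fun a b ↦ ∑ j, g j * C (l (β a j) b)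
  have hD : ∀ q, (eval q).mapMatrix D = Matrix.of fun a ↦ l (∑ j, eval q (g j) • β a j) := by
    intro q
    ext a b
    simp [D]
  refine ⟨D.det, fun h ↦ ?_, fun q hq ↦ ?_⟩
  · have hD₀ : (eval q₀).mapMatrix D = 1 := by
      ext a b
      have := congrFun (LinearMap.congr_fun hl (Pi.single a 1)) b
      simp only [LinearMap.comp_apply, Fintype.linearCombination_apply_single, one_smul,
        LinearMap.id_apply] at this
      rw [hD, Matrix.of_apply, this, Matrix.one_apply, Pi.single_apply]
      simp only [eq_comm]
    have := (eval q₀).map_det D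
    rw [h, hD₀, map_zero, Matrix.det_one] at this
    exact zero_ne_one this
  · rw [RingHom.map_det, hD] at hq
    exact LinearIndependent.of_comp l (Matrix.linearIndependent_rows_of_det_ne_zero hq)

variable {k : Type*} [Field k] {n r s m δ : ℕ} {f : Fin (r + 1) → MvPolynomial (Fin (n + 1)) k}
  {q : Fin (n + 1) → k}

theorem exists_isPrime_rowIdealAt_le {i : Fin (r + 1)} (hi : eval q (f i) ≠ 0) :
    ∃ Q : Ideal (MvPolynomial (Fin (n + 1)) k), Q.IsPrime ∧
      rowIdealAt (Submodule.span k (Set.range f)) q ≤ Q ∧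
      (Q.height : WithBot ℕ∞) + 1 ≤ analyticSpread f := by
  have hker : (RingHom.ker (eval q)).IsPrime := RingHom.ker_isPrime _
  obtain ⟨Q, hQ, hQq⟩ := Ideal.exists_minimalPrimes_le
    (vanishingIdealAt_le_ker_eval (U := Submodule.span k (Set.range f)) (q := q))
  have hQp : Q.IsPrime := hQ.1.1
  have hiQ : f i ∉ Q := fun h ↦ hi (hQq h)
  refine ⟨Q, hQp, fun a ha ↦ ?_, ?_⟩
  · have hai := mem_rowIdealAt.1 ha (f i) (Submodule.subset_span ⟨i, rfl⟩)
    exact (hQp.mem_or_mem (hQ.1.2 hai)).resolve_right hiQ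
  · rw [analyticSpread]
    gcongr
    exact height_le_topologicalKrullDim_ratImage (fun u hu ↦ hu.1) hQ hiQ

theorem rowIdealAt_eq_of_analyticSpread_le {i : Fin (r + 1)} (hi : eval q (f i) ≠ 0)
    {P : Ideal (MvPolynomial (Fin (n + 1)) k)} [P.IsPrime]
    (hP : P ≤ rowIdealAt (Submodule.span k (Set.range f)) q)
    (hht : analyticSpread f ≤ (P.height : WithBot ℕ∞) + 1) :
    rowIdealAt (Submodule.span k (Set.range f)) q = P ∧
      (P.height : WithBot ℕ∞) + 1 = analyticSpread f := by
  obtain ⟨Q, hQ, hRQ, hQht⟩ := exists_isPrime_rowIdealAt_le hi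
  have hQP : Q.height ≤ P.height := by
    have := hQht.trans hht
    norm_cast at this
    exact (WithTop.add_le_add_iff_right ENat.one_ne_top).1 this
  obtain rfl := Ideal.eq_of_le_of_height_le P (hP.trans hRQ) hQP
  exact ⟨le_antisymm hRQ hP, le_antisymm hQht hht⟩

variable [Infinite k] {g : Fin s → MvPolynomial (Fin (n + 1)) k}
  {A : Matrix (Fin s) (Fin m) (MvPolynomial (Fin (n + 1)) k)} {i : Fin s}

theorem exists_ne_zero_forall_exists_isLinear_le_rowIdealAt (hg : ∀ j, (g j).IsHomogeneous δ)
    (hA : Function.Exact A.mulVecLin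
      (Fintype.linearCombination (MvPolynomial (Fin (n + 1)) k) g))
    (hlin : IsLinear (rowIdeal A i)) (hne : ¬ Ideal.span (Set.range g) ≤ rowIdeal A i)
    {U : Submodule k (MvPolynomial (Fin (n + 1)) k)} (hgU : ∀ j, g j ∈ U) :
    ∃ h : MvPolynomial (Fin (n + 1)) k, h ≠ 0 ∧ ∀ q, eval q h ≠ 0 →
      ∃ P, IsLinear P ∧ P.height = (rowIdeal A i).height ∧ P ≤ rowIdealAt U q := by
  obtain ⟨v, β, hβ1, hβ, hβi, hv⟩ := exists_linear_syzygies hg hA hlin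
  obtain ⟨q₀, hq₀, hq₀'⟩ := exists_eval_ne_zero_forall_eval_eq_zero hA hlin hne
  have h₀ : LinearIndependent k fun a ↦ ∑ j, eval q₀ (g j) • β a j := by
    have hsum : ∀ a, ∑ j, eval q₀ (g j) • β a j = eval q₀ (g i) • β a i := fun a ↦
      Fintype.sum_eq_single i fun j hj ↦ by rw [hq₀' j hj, zero_smul]
    simp only [hsum]
    exact hβi.units_smul fun _ ↦ Units.mk0 _ hq₀
  obtain ⟨h, h0, hh⟩ := exists_ne_zero_forall_linearIndependent g β h₀
  refine ⟨h, h0, fun q hq ↦ ?_⟩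
  let V := Submodule.span k (Set.range fun a ↦ ∑ j, eval q (g j) • β a j)
  have hV : V ≤ homogeneousSubmodule (Fin (n + 1)) k 1 := by
    refine Submodule.span_le.2 ?_
    rintro _ ⟨a, rfl⟩
    exact Submodule.sum_mem _ fun j _ ↦ Submodule.smul_mem _ _ (hβ1 a j)
  refine ⟨Ideal.span V, ⟨V, hV, rfl⟩, ?_, ?_⟩
  · rw [hv, height_span_eq_finrank hV, finrank_span_eq_card (hh q hq), Fintype.card_fin]
  · rw [Ideal.span, Submodule.span_span_of_tower, ← Ideal.span, Ideal.span_le]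
    rintro _ ⟨a, rfl⟩
    exact sum_eval_smul_mem_rowIdealAt hgU (hβ a)

theorem exists_ne_zero_forall_isLinear_rowIdealAt (hf : ∀ j, (f j).IsHomogeneous δ)
    (hA : IsHomogeneousPresentation (Ideal.span (Set.range f)) g A)
    (hlin : IsLinear (rowIdeal A i))
    (hht : analyticSpread f ≤ ((rowIdeal A i).height : WithBot ℕ∞) + 1)
    (hne : ¬ Ideal.span (Set.range f) ≤ rowIdeal A i) :
    ∃ h : MvPolynomial (Fin (n + 1)) k, h ≠ 0 ∧ ∀ q, eval q h ≠ 0 →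
      IsLinear (rowIdealAt (Submodule.span k (Set.range f)) q) ∧
      ((rowIdealAt (Submodule.span k (Set.range f)) q).height : WithBot ℕ∞) + 1 =
        analyticSpread f ∧
      ∃ j, eval q (f j) ≠ 0 := by
  set U := Submodule.span k (Set.range f)
  have hfU : Ideal.span (U : Set (MvPolynomial (Fin (n + 1)) k)) = Ideal.span (Set.range f) :=
    Submodule.span_span_of_tower k _ _
  have hUδ : U ≤ homogeneousSubmodule (Fin (n + 1)) k δ :=
    Submodule.span_le.2 (Set.range_subset_iff.2 hf)
  obtain ⟨c, -, hc, -⟩ := hA.homogeneous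
  have hg : ∀ j, (g j).IsHomogeneous δ := fun j ↦
    isHomogeneous_of_minimal (Set.forall_mem_range.2 hf) hA.span_eq hc (hA.minimal j)
  have hgU : ∀ j, g j ∈ U := fun j ↦ (mem_ideal_span_iff_of_isHomogeneous hUδ (hg j)).1
    (hfU ▸ hA.span_eq ▸ Ideal.subset_span ⟨j, rfl⟩)
  obtain ⟨j, hj⟩ : ∃ j, f j ≠ 0 := by
    by_contra! hall
    refine hne (Ideal.span_le.2 (Set.range_subset_iff.2 fun j ↦ ?_))
    exact (hall j).symm ▸ Ideal.zero_mem _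
  obtain ⟨h, h0, hh⟩ := exists_ne_zero_forall_exists_isLinear_le_rowIdealAt hg hA.exact_seq hlin
    (hA.span_eq ▸ hne) hgU
  refine ⟨h * f j, mul_ne_zero h0 hj, fun q hq ↦ ?_⟩
  rw [map_mul] at hq
  obtain ⟨P, hPlin, hPht, hPU⟩ := hh q (left_ne_zero_of_mul hq)
  have := hPlin.isPrime
  have hjq : eval q (f j) ≠ 0 := right_ne_zero_of_mul hq
  obtain ⟨hRP, hRht⟩ := rowIdealAt_eq_of_analyticSpread_le hjq hPU (hPht ▸ hht)
  exact ⟨hRP ▸ hPlin, hRP ▸ hRht, j, hjq⟩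

end GenericRowIdeals

section Powers

theorem pow_le_homogeneousSubmodule {σ R : Type*} [CommSemiring R] {δ : ℕ}
    {U : Submodule R (MvPolynomial σ R)} (hU : U ≤ homogeneousSubmodule σ R δ) (d : ℕ) :
    U ^ d ≤ homogeneousSubmodule σ R (d * δ) := by
  induction d with
  | zero =>
    rw [pow_zero, zero_mul, Submodule.one_le]
    exact isHomogeneous_one _ _
  | succ d ih =>
    rw [pow_succ, add_mul, one_mul]
    exact (mul_le_mul' ih hU).trans (homogeneousSubmodule_mul _ _)

open scoped Pointwise in
theorem ideal_span_pow {k A : Type*} [CommSemiring k] [CommSemiring A] [Algebra k A]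
    (U : Submodule k A) (d : ℕ) :
    Ideal.span ((U ^ d : Submodule k A) : Set A) = Ideal.span (U : Set A) ^ d := by
  have hUd : U ^ d = Submodule.span k ((U : Set A) ^ d) := by
    rw [← Submodule.span_pow, Submodule.span_eq]
  rw [hUd, Ideal.span, Submodule.span_span_of_tower, ← Submodule.span_pow, ← Ideal.span]

variable {σ k : Type*} [Field k] {U : Submodule k (MvPolynomial σ k)} {q : σ → k}
  {u₀ : MvPolynomial σ k}

theorem vanishingIdealAt_pow_le (hu₀ : u₀ ∈ U) (hq : eval q u₀ ≠ 0) (d : ℕ) :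
    vanishingIdealAt (U ^ d) q ≤ vanishingIdealAt U q := by
  refine Ideal.span_le.2 fun u ⟨hu, huq⟩ ↦ ?_
  let π := Ideal.Quotient.mkₐ k (vanishingIdealAt U q)
  have hπ : ∀ a, π a = 0 ↔ a ∈ vanishingIdealAt U q := fun a ↦ Ideal.Quotient.eq_zero_iff_mem
  -- Modulo `vanishingIdealAt U q` the space `U` is spanned by `u₀`, hence `U ^ d` by `u₀ ^ d`.
  have hU : U.map π.toLinearMap ≤ Submodule.span k {π u₀} := by
    rintro _ ⟨a, ha, rfl⟩
    refine Submodule.mem_span_singleton.2 ⟨eval q a / eval q u₀, ?_⟩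
    rw [AlgHom.toLinearMap_apply, ← map_smul, ← sub_eq_zero, ← map_sub, hπ]
    refine Ideal.subset_span ⟨U.sub_mem (U.smul_mem _ hu₀) ha, ?_⟩
    simp [smul_eval, hq]
  have hπu : π u ∈ Submodule.span k {π u₀} ^ d :=
    pow_le_pow_left' hU d (Submodule.map_pow U π d ▸ Submodule.mem_map_of_mem hu)
  rw [Submodule.span_pow, Set.singleton_pow, Submodule.mem_span_singleton] at hπu
  obtain ⟨c, hc⟩ := hπu
  have hcu : c • u₀ ^ d - u ∈ vanishingIdealAt U q := by
    rw [← hπ, map_sub, map_smul, map_pow, hc, sub_self]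
  have hc0 : c = 0 := by
    have : eval q (c • u₀ ^ d - u) = 0 := vanishingIdealAt_le_ker_eval hcu
    simpa [smul_eval, huq, hq] using this
  simpa [hc0] using hcu

theorem rowIdealAt_le_rowIdealAt_mul (W U : Submodule k (MvPolynomial σ k)) (q : σ → k) :
    rowIdealAt U q ≤ rowIdealAt (W * U) q := fun a ha ↦ by
  refine mem_rowIdealAt.2 fun u hu ↦ ?_
  induction hu using Submodule.mul_induction_on' with
  | add x _ y _ hx hy => exact mul_add a x y ▸ Ideal.add_mem _ hx hy
  | mem_mul_mem w hw u hu =>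
    have hle : vanishingIdealAt U q ≤
        Submodule.comap (LinearMap.mulLeft (MvPolynomial σ k) w) (vanishingIdealAt (W * U) q) :=
      Ideal.span_le.2 fun z hz ↦ Ideal.subset_span
        ⟨Submodule.mul_mem_mul hw hz.1, by simp [hz.2]⟩
    exact mul_left_comm a w u ▸ hle (mem_rowIdealAt.1 ha u hu)

theorem rowIdealAt_pow (hR : (rowIdealAt U q).IsPrime) (hu₀ : u₀ ∈ U) (hq : eval q u₀ ≠ 0)
    {d : ℕ} (hd : 1 ≤ d) : rowIdealAt (U ^ d) q = rowIdealAt U q := by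
  refine le_antisymm (fun a ha ↦ ?_) ?_
  · have hau : a * u₀ ^ d ∈ rowIdealAt U q :=
      vanishingIdealAt_le_rowIdealAt <| vanishingIdealAt_pow_le hu₀ hq d <|
        mem_rowIdealAt.1 ha _ (Submodule.pow_mem_pow U hu₀ d)
    refine (hR.mem_or_mem hau).resolve_right fun h ↦ hq ?_
    exact rowIdealAt_le_ker_eval hu₀ hq (hR.mem_of_pow_mem d h)
  · obtain ⟨e, rfl⟩ := Nat.exists_eq_add_of_le' hd
    rw [pow_succ]
    exact rowIdealAt_le_rowIdealAt_mul _ _ _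

end Powers

section DualBases

theorem exists_basis_forall_coord_mem {K V : Type*} [Field K] [AddCommGroup V] [Module K V]
    [Module.Finite K V] {T : Set (Module.Dual K V)} (hT : Submodule.span K T = ⊤) :
    ∃ (N : ℕ) (b : Module.Basis (Fin N) K V), ∀ i, b.coord i ∈ T := by
  let c := Module.Basis.ofSpan hT.ge
  let c' := c.reindex (c.indexEquiv (Module.finBasis K (Module.Dual K V)))
  refine ⟨_, c'.dualBasis.map (Module.evalEquiv K V).symm, fun i ↦ ?_⟩
  have hcoord : (c'.dualBasis.map (Module.evalEquiv K V).symm).coord i = c' i := by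
    ext v
    simp
  rw [hcoord, Module.Basis.reindex_apply]
  exact Module.Basis.ofSpan_subset hT.ge ⟨_, rfl⟩

variable {σ k : Type*} [Field k] {W : Submodule k (MvPolynomial σ k)}

theorem exists_basis_coord_eq_eval [Infinite k] (W : Submodule k (MvPolynomial σ k))
    [Module.Finite k W] {h : MvPolynomial σ k} (h0 : h ≠ 0) :
    ∃ (N : ℕ) (b : Module.Basis (Fin N) k W) (q : Fin N → σ → k),
      ∀ i, eval (q i) h ≠ 0 ∧ ∀ u : W, b.coord i u = eval (q i) u.1 := by
  let ev : (σ → k) → Module.Dual k W := fun q ↦ (aeval q).toLinearMap ∘ₗ W.subtype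
  have hspan : Submodule.span k (ev '' {q | eval q h ≠ 0}) = ⊤ := by
    refine Submodule.span_eq_top_of_ne_zero fun u hu ↦ ?_
    have huh : u.1 * h ≠ 0 := mul_ne_zero (by simpa using hu) h0
    obtain ⟨q, hq⟩ : ∃ q, eval q (u.1 * h) ≠ 0 := by
      by_contra! hall
      exact huh (MvPolynomial.funext (by simpa using hall))
    rw [map_mul] at hq
    exact ⟨_, ⟨q, right_ne_zero_of_mul hq, rfl⟩, left_ne_zero_of_mul hq⟩
  obtain ⟨N, b, hb⟩ := exists_basis_forall_coord_mem hspan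
  choose q hq hqb using hb
  exact ⟨N, b, q, fun i ↦ ⟨hq i, fun u ↦ by rw [← hqb]; rfl⟩⟩

theorem ideal_span_range_basis {ι k A : Type*} [CommSemiring k] [CommSemiring A] [Algebra k A]
    {W : Submodule k A} (b : Module.Basis ι k W) :
    Ideal.span (Set.range fun i ↦ (b i : A)) = Ideal.span (W : Set A) := by
  have hW : Submodule.span k (Set.range fun i ↦ (b i : A)) = W := by
    have := congrArg (Submodule.map W.subtype) b.span_eq
    rwa [Submodule.map_span, ← Set.range_comp, Submodule.map_top, Submodule.range_subtype] at this
  conv_rhs => rw [← hW]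
  rw [Ideal.span, Ideal.span, Submodule.span_span_of_tower]

variable {ι : Type*} {b : Module.Basis ι k W} {i : ι} {q : σ → k}

theorem eval_basis_self (hq : ∀ u : W, b.coord i u = eval q u.1) : eval q (b i).1 = 1 := by
  rw [← hq, Module.Basis.coord_apply, b.repr_self, Finsupp.single_eq_same]

theorem ideal_span_image_compl_eq_vanishingIdealAt (hq : ∀ u : W, b.coord i u = eval q u.1) :
    Ideal.span ((fun j ↦ (b j).1) '' {i}ᶜ) = vanishingIdealAt W q := by
  refine le_antisymm (Ideal.span_mono ?_) (Ideal.span_le.2 fun u ⟨hu, huq⟩ ↦ ?_)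
  · rintro _ ⟨j, hj, rfl⟩
    refine ⟨(b j).2, ?_⟩
    rw [← hq, Module.Basis.coord_apply, b.repr_self, Finsupp.single_eq_of_ne' hj]
  · have hi : b.repr ⟨u, hu⟩ i = 0 := (hq ⟨u, hu⟩).trans huq
    have hsum := congrArg W.subtype (b.linearCombination_repr ⟨u, hu⟩)
    rw [Finsupp.linearCombination_apply, map_finsuppSum] at hsum
    change _ = u at hsum
    rw [SetLike.mem_coe, ← hsum]
    refine Ideal.sum_mem _ fun j hj ↦ Submodule.smul_of_tower_mem _ _ (Ideal.subset_span ?_)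
    exact ⟨j, fun hji ↦ Finsupp.mem_support_iff.1 hj (hji ▸ hi), rfl⟩

theorem ideal_span_image_compl_ne_ideal_span_range (hq : ∀ u : W, b.coord i u = eval q u.1) :
    Ideal.span ((fun j ↦ (b j).1) '' {i}ᶜ) ≠ Ideal.span (Set.range fun j ↦ (b j).1) := by
  intro h
  have hi : (b i).1 ∈ vanishingIdealAt W q := by
    rw [← ideal_span_image_compl_eq_vanishingIdealAt hq, h]
    exact Ideal.subset_span ⟨i, rfl⟩
  exact one_ne_zero ((eval_basis_self hq).symm.trans (vanishingIdealAt_le_ker_eval hi))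

theorem mem_rowIdealAt_iff_mul_mem (hq : ∀ u : W, b.coord i u = eval q u.1)
    {a : MvPolynomial σ k} : a ∈ rowIdealAt W q ↔ a * (b i).1 ∈ vanishingIdealAt W q := by
  refine ⟨fun ha ↦ mem_rowIdealAt.1 ha _ (b i).2, fun ha ↦ mem_rowIdealAt.2 fun u hu ↦ ?_⟩
  have hsub : u - eval q u • (b i).1 ∈ vanishingIdealAt W q :=
    Ideal.subset_span ⟨W.sub_mem hu (W.smul_mem _ (b i).2), by
      simp [smul_eval, eval_basis_self hq]⟩
  have hau : a * u = a * (u - eval q u • (b i).1) + eval q u • (a * (b i).1) := by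
    rw [mul_sub, mul_smul_comm, sub_add_cancel]
  rw [hau]
  exact Ideal.add_mem _ (Ideal.mul_mem_left _ a hsub) (Submodule.smul_of_tower_mem _ _ ha)

end DualBases

section RowIdealsOfBases

variable {k : Type*} [Field k] {n N m : ℕ} {W : Submodule k (MvPolynomial (Fin (n + 1)) k)}
  {b : Module.Basis (Fin N) k W} {i : Fin N} {q : Fin (n + 1) → k}

theorem rowIdeal_eq_rowIdealAt
    {A : Matrix (Fin N) (Fin m) (MvPolynomial (Fin (n + 1)) k)}
    (hA : Function.Exact A.mulVecLin
      (Fintype.linearCombination (MvPolynomial (Fin (n + 1)) k) fun j ↦ (b j).1))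
    (hq : ∀ u : W, b.coord i u = eval q u.1) : rowIdeal A i = rowIdealAt W q := by
  ext a
  rw [mem_rowIdeal_iff_mul_mem_span hA, ideal_span_image_compl_eq_vanishingIdealAt hq,
    mem_rowIdealAt_iff_mul_mem hq]

end RowIdealsOfBases

end RowIdeals

open MvPolynomial RowIdeals in
theorem mainTheorem1_general {k : Type*} [Field k] [Infinite k] {n r δ : ℕ}
    (f : Fin (r + 1) → MvPolynomial (Fin (n + 1)) k) (hdeg : ∀ i, (f i).IsHomogeneous δ)
    (I : Ideal (MvPolynomial (Fin (n + 1)) k)) (hI : I = Ideal.span (Set.range f))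
    (hrow : ∃ (s m : ℕ) (g : Fin s → MvPolynomial (Fin (n + 1)) k)
      (A : Matrix (Fin s) (Fin m) (MvPolynomial (Fin (n + 1)) k)),
      IsHomogeneousPresentation I g A ∧
      ∃ i, IsLinear (rowIdeal A i) ∧
        analyticSpread f ≤ ((rowIdeal A i).height : WithBot ℕ∞) + 1 ∧ ¬ I ≤ rowIdeal A i)
    (d : ℕ) (hd : 1 ≤ d) :
    ∃ (s m : ℕ) (g : Fin s → MvPolynomial (Fin (n + 1)) k)
      (A : Matrix (Fin s) (Fin m) (MvPolynomial (Fin (n + 1)) k)),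
      IsHomogeneousPresentation (I ^ d) g A ∧
      ∀ i, IsLinear (rowIdeal A i) ∧
        ((rowIdeal A i).height : WithBot ℕ∞) + 1 = analyticSpread f ∧ ¬ I ≤ rowIdeal A i := by
  subst hI
  obtain ⟨s, m, g, A, hA, i, hlin, hht, hne⟩ := hrow
  obtain ⟨h, h0, hh⟩ := exists_ne_zero_forall_isLinear_rowIdealAt hdeg hA hlin hht hne
  set U := Submodule.span k (Set.range f) with hU
  have hfU : ∀ j, f j ∈ U := fun j ↦ Submodule.subset_span ⟨j, rfl⟩
  have hUδ : U ^ d ≤ homogeneousSubmodule (Fin (n + 1)) k (d * δ) :=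
    pow_le_homogeneousSubmodule (Submodule.span_le.2 (Set.range_subset_iff.2 hdeg)) d
  have := finiteDimensional_of_le_homogeneousSubmodule hUδ
  obtain ⟨N, b, q, hbq⟩ := exists_basis_coord_eq_eval (U ^ d) h0
  obtain ⟨l, B, hB⟩ := exists_isHomogeneousPresentation (fun j ↦ hUδ (b j).2)
    fun j ↦ ideal_span_image_compl_ne_ideal_span_range (hbq j).2
  have hspan : Ideal.span (Set.range fun j ↦ (b j).1) = Ideal.span (Set.range f) ^ d := by
    rw [ideal_span_range_basis, ideal_span_pow, Ideal.span, hU, Submodule.span_span_of_tower]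
  refine ⟨N, l, fun j ↦ (b j).1, B, hspan ▸ hB, fun j ↦ ?_⟩
  obtain ⟨hRlin, hRht, i₀, hi₀⟩ := hh (q j) (hbq j).1
  rw [rowIdeal_eq_rowIdealAt hB.exact_seq (hbq j).2, rowIdealAt_pow hRlin.isPrime (hfU i₀) hi₀ hd]
  refine ⟨hRlin, hRht, fun hle ↦ hi₀ ?_⟩
  exact rowIdealAt_le_ker_eval (hfU i₀) hi₀ (hle (Ideal.subset_span ⟨i₀, rfl⟩))

open MvPolynomial RowIdeals in
theorem mainTheorem1 {k : Type*} [Field k] [Infinite k] {n r δ : ℕ}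
    (f : Fin (r + 1) → MvPolynomial (Fin (n + 1)) k)
    (hdeg : ∀ i, (f i).IsHomogeneous δ) (hind : LinearIndependent k f)
    (I : Ideal (MvPolynomial (Fin (n + 1)) k)) (hI : I = Ideal.span (Set.range f))
    (hrow : ∃ (s m : ℕ) (g : Fin s → MvPolynomial (Fin (n + 1)) k)
      (A : Matrix (Fin s) (Fin m) (MvPolynomial (Fin (n + 1)) k)),
      RowIdeals.IsHomogeneousPresentation I g A ∧
      ∃ i, RowIdeals.IsLinear (RowIdeals.rowIdeal A i) ∧
        RowIdeals.analyticSpread f ≤ ((RowIdeals.rowIdeal A i).height : WithBot ℕ∞) + 1 ∧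
        ¬ I ≤ RowIdeals.rowIdeal A i)
    (d : ℕ) (hd : 1 ≤ d) :
    ∃ (s m : ℕ) (g : Fin s → MvPolynomial (Fin (n + 1)) k)
      (A : Matrix (Fin s) (Fin m) (MvPolynomial (Fin (n + 1)) k)),
      RowIdeals.IsHomogeneousPresentation (I ^ d) g A ∧
      ∀ i, RowIdeals.IsLinear (RowIdeals.rowIdeal A i) ∧
        ((RowIdeals.rowIdeal A i).height : WithBot ℕ∞) + 1 = RowIdeals.analyticSpread f ∧
        ¬ I ≤ RowIdeals.rowIdeal A i :=
  mainTheorem1_general f hdeg I hI hrow d hd
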